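/- For an integer $k\ge 0$ let $W_k=\{(x_1,\dots,x_k)\in\mathbb{Z}^k : x_1>x_2>\dots>x_k>0\}$ and $\delta=(k,k-1,\dots,1)\in W_k$, and let $e_1,\dots,e_k$ be the standard basis vectors. An oscillating tableau of length $n$ is a sequence $\lambda^0,\lambda^1,\dots,\lambda^n$ of Ferrers diagrams with $\lambda^0=\emptyset$ in which each $\lambda^{s+1}$ is obtained from $\lambda^s$ by adding or by deleting one box; its height is at most $k$ if every $\lambda^s$ has at most $k$ rows. A $W_k$-oscillating walk of length $n$ is a sequence of $n+1$ points of $W_k$ that starts at $\delta$ and in which each step is $e_i$ or $-e_i$ for some $1\le i\le k$. An open matching diagram on the vertices $1,\dots,n$ consists of arcs $(i,j)$ with $i<j$ and of open arcs, which have a left endpoint but no right endpoint, such that every vertex is an endpoint of exactly one arc or open arc. An $r$-nesting is a set of $r$ arcs $(i_1,j_1),\dots,(i_r,j_r)$ with $i_1<\dots<i_r<j_r<\dots<j_1$; a future $r$-nesting (for $r\ge 1$) is an open arc together with an $(r-1)$-nesting all of whose vertices lie to the right of the left endpoint of the open arc (for $r=1$: just an open arc). Theorem. For all nonnegative integers $n,m,k$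 the following sets are in bijection: 1. the oscillating tableaux of length $n$ and height at most $k$ that end in the one-row shape $(m)$, where $(0)=\emptyset$; 2. the $W_k$-oscillating walks of length $n$ that end at $(m+k,k-1,\dots,1)=\delta+me_1$; 3. the open matching diagrams on $n$ vertices with $m$ open arcs that have no $(k+1)$-nesting and no future $(k+1)$-nesting. (If $k=0$ and $m>0$, the endpoint in 2 does not exist, and the claim is only that 1 and 3 are in bijection; if $k=0$ and $m=0$, the endpoint in 2 is $\delta$, the only point of $W_0=\mathbb{Z}^0$.) -/

import Mathlib

/-- `ν` is obtained from `μ` by adding one box. -/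
def YoungDiagram.AddBox (μ ν : YoungDiagram) : Prop :=
  ∃ c : ℕ × ℕ, c ∉ μ.cells ∧ ν.cells = insert c μ.cells

/-- The Ferrers diagram consisting of a single row of length `m` (empty if `m = 0`). -/
def rowShape (m : ℕ) : YoungDiagram where
  cells := {0} ×ˢ Finset.range m
  isLowerSet := by
    rintro ⟨a, b⟩ ⟨c, d⟩ ⟨h₁, h₂⟩ h
    simp only [Finset.coe_product, Finset.coe_singleton, Finset.coe_range, Set.mem_prod,
      Set.mem_singleton_iff, Set.mem_Iio] at h ⊢
    simp only at h₁ h₂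
    omega

/-- Oscillating tableaux of length `n` and height at most `k` that end in a row of length `m`:
sequences of `n + 1` Ferrers diagrams starting from the empty one, in which every step adds or
deletes one box. The height of a diagram is its number of rows, the length of its first column. -/
def oscillatingTableaux (n k m : ℕ) : Set (Fin (n + 1) → YoungDiagram) :=
  {t | t 0 = ⊥ ∧
    (∀ s : Fin n, (t s.castSucc).AddBox (t s.succ) ∨ (t s.succ).AddBox (t s.castSucc)) ∧
    (∀ s, (t s).colLen 0 ≤ k) ∧
    t (Fin.last n) = rowShape m}

/-- `W_k`: integer vectors `(x₁, …, x_k)` with `x₁ > x₂ > ⋯ > x_k > 0`. -/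
def weylChamber (k : ℕ) : Set (Fin k → ℤ) :=
  {x | StrictAnti x ∧ ∀ i, 0 < x i}

/-- The point `δ = (k, k - 1, …, 1)`. -/
def weylDelta (k : ℕ) : Fin k → ℤ := fun i => (k : ℤ) - (i : ℕ)

/-- The point `(m + k, k - 1, …, 1) = δ + m e₁`. It makes sense for `k ≥ 1`, and for `m = 0`,
where it is `δ`. -/
def rowPoint (k m : ℕ) : Fin k → ℤ :=
  fun i => weylDelta k i + if (i : ℕ) = 0 then (m : ℤ) else 0

/-- `W_k`-oscillating walks of length `n` from `δ` to `p`, as sequences of `n + 1` positions: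
they stay in `W_k`, and every step is some `e_j` or `-e_j`. -/
def oscillatingWalks (n k : ℕ) (p : Fin k → ℤ) : Set (Fin (n + 1) → Fin k → ℤ) :=
  {w | w 0 = weylDelta k ∧
    (∀ s, w s ∈ weylChamber k) ∧
    (∀ s : Fin n, ∃ j : Fin k,
      w s.succ = w s.castSucc + Pi.single j 1 ∨ w s.succ = w s.castSucc - Pi.single j 1) ∧
    w (Fin.last n) = p}

/-- Open matching diagrams on `n` vertices in a row: arcs `(i, j)` with `i < j`, and open arcs,
which have a left endpoint only. Every vertex is an endpoint of exactly one arc or open arc. -/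
@[ext]
structure OpenMatching (n : ℕ) where
  arcs : Finset (Fin n × Fin n)
  /-- the left endpoints of the open arcs -/
  openArcs : Finset (Fin n)
  lt_of_mem : ∀ a ∈ arcs, a.1 < a.2
  incidence : ∀ v : Fin n,
    (v ∉ openArcs ∧ ∃! a, a ∈ arcs ∧ (a.1 = v ∨ a.2 = v)) ∨
    (v ∈ openArcs ∧ ∀ a ∈ arcs, a.1 ≠ v ∧ a.2 ≠ v)

namespace OpenMatching

variable {n : ℕ}

/-- The arcs `(i₁, j₁), …, (i_r, j_r)` of `D` satisfy `i₁ < ⋯ < i_r < j_r < ⋯ < j₁`. -/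
def IsNesting (D : OpenMatching n) {r : ℕ} (i j : Fin r → Fin n) : Prop :=
  (∀ a, (i a, j a) ∈ D.arcs) ∧ StrictMono i ∧ StrictAnti j ∧ ∀ a b, i a < j b

/-- `D` contains an `r`-nesting. -/
def HasNesting (D : OpenMatching n) (r : ℕ) : Prop :=
  ∃ i j : Fin r → Fin n, D.IsNesting i j

/-- `D` contains a future `r`-nesting: an open arc to the left of an `(r - 1)`-nesting. -/
def HasFutureNesting (D : OpenMatching n) (r : ℕ) : Prop :=
  ∃ s : ℕ, r = s + 1 ∧ ∃ v ∈ D.openArcs, ∃ i j : Fin s → Fin n,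
    D.IsNesting i j ∧ ∀ a, v < i a

end OpenMatching

/-- Open matching diagrams on `n` vertices with `m` open arcs, with no `(k + 1)`-nesting and no
future `(k + 1)`-nesting. -/
def nonnestingOpenMatchings (n k m : ℕ) : Set (OpenMatching n) :=
  {D | D.openArcs.card = m ∧ ¬ D.HasNesting (k + 1) ∧ ¬ D.HasFutureNesting (k + 1)}

/-!
Oscillating tableaux and open matching diagrams are two boundaries of the same growth diagram.
Draw the arc from `i` to `j` as a cross in the square with bottom-left corner `(i, n - 1 - j)`,
below the antidiagonal of a triangular grid of size `n`. Put empty shapes on one axis and, on the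
other, one-row shapes that grow by a box at each open arc, and fill the grid by the local rule of
the dual Robinson–Schensted correspondence. In terms of column lengths the rule computes the
top-right shape of a square from the three others and the cross, and recovers the bottom-left
shape and the cross from the three others. Counting boxes, every vertex lies on exactly one arc or
open arc if and only if consecutive shapes on the antidiagonal differ by one box, so that the
antidiagonal is an oscillating tableau, and it determines the two antidiagonals from which the
whole diagram is recovered.

As in Schensted's theorem, the first column of a shape measures the longest chain of crosses to its
lower left, that is, the largest nesting, and a chain to the right of an open arc counts one more
because it starts from a nonempty row: these are the future nestings. Row lengths shifted by `δ`
turn tableaux of height at most `k` into walks in `W_k`.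
-/

open Finset

section Diagrams

open YoungDiagram

theorem colLen_injective : Function.Injective YoungDiagram.colLen := by
  intro μ ν h
  ext ⟨i, j⟩
  rw [mem_cells, mem_cells, mem_iff_lt_colLen, mem_iff_lt_colLen, h]

theorem rowLen_injective : Function.Injective YoungDiagram.rowLen := by
  intro μ ν h
  ext ⟨i, j⟩
  rw [mem_cells, mem_cells, mem_iff_lt_rowLen, mem_iff_lt_rowLen, h]

theorem le_iff_colLen_le {μ ν : YoungDiagram} : μ ≤ ν ↔ ∀ c, μ.colLen c ≤ ν.colLen c := by
  constructor
  · intro h c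
    by_contra! hc
    exact absurd (mem_iff_lt_colLen.mp (h (mem_iff_lt_colLen.mpr hc))) (lt_irrefl _)
  · rintro h ⟨i, c⟩ hi
    exact mem_iff_lt_colLen.mpr ((mem_iff_lt_colLen.mp hi).trans_le (h c))

theorem colLen_bot (c : ℕ) : (⊥ : YoungDiagram).colLen c = 0 := by
  by_contra h
  exact notMem_bot (0, c) (mem_iff_lt_colLen.mpr (Nat.pos_of_ne_zero h))

theorem rowLen_bot (i : ℕ) : (⊥ : YoungDiagram).rowLen i = 0 := by
  by_contra h
  exact notMem_bot (i, 0) (mem_iff_lt_rowLen.mpr (Nat.pos_of_ne_zero h))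

theorem rowLen_eq_zero_iff {μ : YoungDiagram} {k : ℕ} : μ.rowLen k = 0 ↔ μ.colLen 0 ≤ k := by
  rw [← not_lt, ← mem_iff_lt_colLen, mem_iff_lt_rowLen, Nat.pos_iff_ne_zero, not_not]

theorem colLen_eq_zero_iff {μ : YoungDiagram} {c : ℕ} : μ.colLen c = 0 ↔ μ.rowLen 0 ≤ c := by
  rw [← not_lt, ← mem_iff_lt_rowLen, mem_iff_lt_colLen, Nat.pos_iff_ne_zero, not_not]

theorem card_eq_sum_colLen {μ : YoungDiagram} {N : ℕ} (hN : μ.colLen N = 0) :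
    μ.card = ∑ c ∈ range N, μ.colLen c := by
  have hmaps : Set.MapsTo Prod.snd (μ.cells : Set (ℕ × ℕ)) (range N) := by
    rintro ⟨i, c⟩ hc
    have hc' : c < μ.rowLen i := mem_iff_lt_rowLen.mp hc
    have := μ.rowLen_anti 0 i i.zero_le
    have := colLen_eq_zero_iff.mp hN
    exact mem_coe.mpr (mem_range.mpr (by omega))
  rw [YoungDiagram.card, card_eq_sum_card_fiberwise hmaps]
  exact sum_congr rfl fun c _ => μ.colLen_eq_card.symm

/-- The diagram with prescribed column lengths. It is only meaningful for an antitone sequence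
that vanishes somewhere; any other sequence gives an arbitrary diagram. -/
noncomputable def ofColLen : (ℕ → ℕ) → YoungDiagram := Function.invFun YoungDiagram.colLen

theorem colLen_ofColLen {p : ℕ → ℕ} (hp : Antitone p) {N : ℕ} (hN : p N = 0) :
    (ofColLen p).colLen = p := by
  let μ : YoungDiagram :=
    { cells := {c ∈ range (p 0) ×ˢ range N | c.1 < p c.2}
      isLowerSet := by
        rintro ⟨a, b⟩ ⟨c, d⟩ ⟨h₁, h₂⟩ h
        simp only [coe_filter, mem_product, mem_range, Set.mem_ofPred_eq] at h h₁ h₂ ⊢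
        have := hp h₂
        omega }
  have hmem (i c : ℕ) : (i, c) ∈ μ ↔ i < p c := by
    have h0 := hp c.zero_le
    have hc : 0 < p c → c < N := fun h => by
      by_contra! hNc
      have := hp hNc
      omega
    rw [← mem_cells]
    simp only [μ, mem_filter, mem_product, mem_range]
    omega
  exact Function.invFun_eq ⟨μ, funext fun c =>
    eq_of_forall_lt_iff fun i => by rw [← mem_iff_lt_colLen, hmem]⟩

theorem exists_rowLen_eq {p : ℕ → ℕ} (hp : Antitone p) {N : ℕ} (hN : p N = 0) :
    ∃ μ : YoungDiagram, μ.rowLen = p :=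
  ⟨(ofColLen p).transpose, funext fun i => by rw [rowLen_transpose, colLen_ofColLen hp hN]⟩

theorem mem_rowShape {m i c : ℕ} : (i, c) ∈ rowShape m ↔ i = 0 ∧ c < m := by
  rw [← mem_cells]
  simp [rowShape, eq_comm, and_comm]

theorem colLen_rowShape (m c : ℕ) : (rowShape m).colLen c = if c < m then 1 else 0 :=
  eq_of_forall_lt_iff fun i => by
    rw [← mem_iff_lt_colLen, mem_rowShape]
    split_ifs <;> omega

theorem rowLen_rowShape (m i : ℕ) : (rowShape m).rowLen i = if i = 0 then m else 0 :=
  eq_of_forall_lt_iff fun c => by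
    rw [← mem_iff_lt_rowLen, mem_rowShape]
    split_ifs <;> omega

theorem card_rowShape (m : ℕ) : (rowShape m).card = m := by
  simp [YoungDiagram.card, rowShape]

theorem rowShape_injective : Function.Injective rowShape :=
  Function.LeftInverse.injective card_rowShape

theorem rowShape_zero : rowShape 0 = ⊥ :=
  colLen_injective (funext fun c => by simp [colLen_rowShape, colLen_bot])

theorem eq_rowShape_card_of_le {μ : YoungDiagram} {m : ℕ} (h : μ ≤ rowShape m) :
    μ = rowShape μ.card := by
  have hcol : μ.colLen 0 ≤ 1 := (le_iff_colLen_le.mp h 0).trans (by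
    rw [colLen_rowShape]
    split_ifs <;> simp)
  have hμ : μ = rowShape (μ.rowLen 0) := by
    refine rowLen_injective (funext fun i => ?_)
    rw [rowLen_rowShape]
    split_ifs with hi
    · rw [hi]
    · exact rowLen_eq_zero_iff.mpr (by omega)
  rw [hμ, card_rowShape]

end Diagrams

section AddBox

open YoungDiagram

variable {ρ μ ν : YoungDiagram}

theorem card_le_card_of_le (h : μ ≤ ν) : μ.card ≤ ν.card := card_le_card h

theorem eq_of_le_of_card_le (hle : μ ≤ ν) (hcard : ν.card ≤ μ.card) : μ = ν :=
  YoungDiagram.ext (eq_of_subset_of_card_le hle hcard)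

theorem addBox_iff : μ.AddBox ν ↔ μ ≤ ν ∧ ν.card = μ.card + 1 := by
  rw [← cells_subset_iff, YoungDiagram.card, YoungDiagram.card, eq_comm (a := #ν.cells),
    ← exists_eq_insert_iff]
  exact exists_congr fun c => and_congr_right fun _ => eq_comm

theorem addBox_or_addBox_iff :
    μ.AddBox ν ∨ ν.AddBox μ ↔ μ.card + ν.card = 2 * (μ ⊓ ν).card + 1 := by
  rw [addBox_iff, addBox_iff]
  constructor
  · rintro (⟨hle, hcard⟩ | ⟨hle, hcard⟩)
    · rw [inf_eq_left.mpr hle]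
      omega
    · rw [inf_eq_right.mpr hle]
      omega
  · intro h
    have hμ := card_le_card_of_le (inf_le_left : μ ⊓ ν ≤ μ)
    have hν := card_le_card_of_le (inf_le_right : μ ⊓ ν ≤ ν)
    obtain hc | hc : μ.card ≤ (μ ⊓ ν).card ∨ ν.card ≤ (μ ⊓ ν).card := by omega
    · have hle := inf_eq_left.mp (eq_of_le_of_card_le inf_le_left hc)
      exact Or.inl ⟨hle, by omega⟩
    · have hle := inf_eq_right.mp (eq_of_le_of_card_le inf_le_right hc)
      exact Or.inr ⟨hle, by omega⟩

theorem eq_inf_of_card_add_card (hμ : ρ ≤ μ) (hν : ρ ≤ ν)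
    (hcard : μ.card + ν.card = 2 * ρ.card + 1) : ρ = μ ⊓ ν := by
  have := card_le_card_of_le (inf_le_left : μ ⊓ ν ≤ μ)
  have := card_le_card_of_le (inf_le_right : μ ⊓ ν ≤ ν)
  exact eq_of_le_of_card_le (le_inf hμ hν) (by omega)

theorem addBox_iff_rowLen : μ.AddBox ν ↔ ∃ i, ν.rowLen = μ.rowLen + Pi.single i 1 := by
  constructor
  · rintro ⟨⟨i, c⟩, hc, hν⟩
    refine ⟨i, funext fun j => ?_⟩
    simp only [rowLen_eq_card, YoungDiagram.row, hν, filter_insert, Pi.add_apply,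
      Pi.single_apply, eq_comm (a := j)]
    split_ifs with h
    · exact card_insert_of_notMem fun hi => hc (mem_filter.mp hi).1
    · rfl
  · rintro ⟨i, hi⟩
    refine ⟨(i, μ.rowLen i), ?_, ?_⟩
    · rw [mem_cells, mem_iff_lt_rowLen]
      exact lt_irrefl _
    · ext ⟨j, c⟩
      rw [mem_insert, mem_cells, mem_cells, mem_iff_lt_rowLen, mem_iff_lt_rowLen, hi,
        Pi.add_apply, Pi.single_apply, Prod.mk.injEq]
      split_ifs with hj
      · subst hj
        omega
      · omega

end AddBox

section Walks

/-- The point of the Weyl chamber attached to a diagram with at most `k` rows: its row lengths,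
shifted by `δ`. -/
def weylPoint (k : ℕ) (μ : YoungDiagram) : Fin k → ℤ := fun i => μ.rowLen i + weylDelta k i

variable {k : ℕ} {μ ν : YoungDiagram}

theorem weylPoint_mem_weylChamber (k : ℕ) (μ : YoungDiagram) :
    weylPoint k μ ∈ weylChamber k := by
  refine ⟨fun i j hij => ?_, fun i => ?_⟩
  · have := μ.rowLen_anti i j hij.le
    simp only [weylPoint, weylDelta]
    omega
  · have := i.2
    simp only [weylPoint, weylDelta]
    omega

theorem injOn_weylPoint : Set.InjOn (weylPoint k) {μ | μ.colLen 0 ≤ k} := by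
  intro μ hμ ν hν h
  refine rowLen_injective (funext fun i => ?_)
  obtain hi | hi := lt_or_ge i k
  · have := congrFun h ⟨i, hi⟩
    simp only [weylPoint] at this
    omega
  · rw [rowLen_eq_zero_iff.mpr (le_trans hμ hi), rowLen_eq_zero_iff.mpr (le_trans hν hi)]

theorem exists_weylPoint_eq {x : Fin k → ℤ} (hx : x ∈ weylChamber k) :
    ∃ μ : YoungDiagram, μ.colLen 0 ≤ k ∧ weylPoint k μ = x := by
  obtain ⟨hanti, hpos⟩ := hx
  let z : ℕ → ℤ := fun i => if h : i < k then x ⟨i, h⟩ - weylDelta k ⟨i, h⟩ else 0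
  have hz : Antitone z := antitone_nat_of_succ_le fun i => by
    simp only [z, weylDelta]
    split_ifs with h1 h2 h2
    · have := hanti (Fin.mk_lt_mk.mpr i.lt_succ_self : (⟨i, h2⟩ : Fin k) < ⟨i + 1, h1⟩)
      push_cast
      omega
    · omega
    · have := hpos ⟨i, h2⟩
      omega
    · rfl
  have hzk : z k = 0 := dif_neg (lt_irrefl k)
  have hzpos (i : ℕ) (hi : i < k) : 0 ≤ z i := hzk ▸ hz hi.le
  obtain ⟨μ, hμ⟩ := exists_rowLen_eq (p := fun i => (z i).toNat)
    (fun i j hij => Int.toNat_le_toNat (hz hij)) (N := k)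
    (by simp only [hzk, Int.toNat_zero])
  refine ⟨μ, rowLen_eq_zero_iff.mp (by simp only [hμ, hzk, Int.toNat_zero]), funext fun i => ?_⟩
  have hzi : z i = x i - weylDelta k i := dif_pos i.2
  rw [weylPoint, hμ, Int.toNat_of_nonneg (hzpos i i.2), hzi, sub_add_cancel]

theorem addBox_iff_weylPoint (hμ : μ.colLen 0 ≤ k) (hν : ν.colLen 0 ≤ k) :
    μ.AddBox ν ↔ ∃ j : Fin k, weylPoint k ν = weylPoint k μ + Pi.single j 1 := by
  rw [addBox_iff_rowLen]
  constructor
  · rintro ⟨c, hc⟩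
    have hck : c < k := by
      by_contra! h
      have := congrFun hc c
      rw [rowLen_eq_zero_iff.mpr (hν.trans h), Pi.add_apply, Pi.single_eq_same] at this
      omega
    refine ⟨⟨c, hck⟩, funext fun i => ?_⟩
    have := congrFun hc i
    simp only [Pi.add_apply, Pi.single_apply, weylPoint, Fin.ext_iff] at this ⊢
    split_ifs at this ⊢ <;> omega
  · rintro ⟨j, hj⟩
    refine ⟨j, funext fun i => ?_⟩
    rw [Pi.add_apply, Pi.single_apply]
    obtain hi | hi := lt_or_ge i k
    · have := congrFun hj ⟨i, hi⟩
      simp only [Pi.add_apply, Pi.single_apply, weylPoint, Fin.ext_iff] at this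
      split_ifs at this ⊢ <;> omega
    · rw [rowLen_eq_zero_iff.mpr (hμ.trans hi), rowLen_eq_zero_iff.mpr (hν.trans hi),
        if_neg (by have := j.2; omega), add_zero]

theorem addBox_or_addBox_iff_weylPoint (hμ : μ.colLen 0 ≤ k) (hν : ν.colLen 0 ≤ k) :
    μ.AddBox ν ∨ ν.AddBox μ ↔ ∃ j : Fin k, weylPoint k ν = weylPoint k μ + Pi.single j 1 ∨
      weylPoint k ν = weylPoint k μ - Pi.single j 1 := by
  rw [addBox_iff_weylPoint hμ hν, addBox_iff_weylPoint hν hμ, exists_or]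
  simp only [eq_sub_iff_add_eq, eq_comm]

theorem weylPoint_bot (k : ℕ) : weylPoint k ⊥ = weylDelta k :=
  funext fun i => by simp [weylPoint, rowLen_bot]

theorem weylPoint_rowShape (k m : ℕ) : weylPoint k (rowShape m) = rowPoint k m := by
  funext i
  simp [weylPoint, rowPoint, rowLen_rowShape, add_comm]

theorem nonempty_tableaux_equiv_walks (n : ℕ) {k m : ℕ} (hkm : 1 ≤ k ∨ m = 0) :
    Nonempty (oscillatingTableaux n k m ≃ oscillatingWalks n k (rowPoint k m)) := by
  have hbot : (⊥ : YoungDiagram).colLen 0 ≤ k := (colLen_bot 0).trans_le k.zero_le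
  have hrow : (rowShape m).colLen 0 ≤ k := by
    rw [colLen_rowShape]
    split_ifs <;> omega
  have hbij : Set.BijOn (fun t s => weylPoint k (t s)) (oscillatingTableaux n k m)
      (oscillatingWalks n k (rowPoint k m)) := by
    refine ⟨?_, ?_, ?_⟩
    · rintro t ⟨hfirst, hstep, hk, hlast⟩
      refine ⟨?_, fun s => weylPoint_mem_weylChamber k _, fun s =>
        (addBox_or_addBox_iff_weylPoint (hk _) (hk _)).mp (hstep s), ?_⟩
      · simp only [hfirst, weylPoint_bot]
      · simp only [hlast, weylPoint_rowShape]
    · rintro t ⟨-, -, ht, -⟩ u ⟨-, -, hu, -⟩ h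
      exact funext fun s => injOn_weylPoint (ht s) (hu s) (congrFun h s)
    · rintro w ⟨hfirst, hmem, hstep, hlast⟩
      choose t hk ht using fun s => exists_weylPoint_eq (hmem s)
      refine ⟨t, ⟨?_, fun s => ?_, hk, ?_⟩, funext ht⟩
      · exact injOn_weylPoint (hk 0) hbot (by rw [ht, hfirst, weylPoint_bot])
      · rw [addBox_or_addBox_iff_weylPoint (hk _) (hk _), ht, ht]
        exact hstep s
      · exact injOn_weylPoint (hk _) hrow (by rw [ht, hlast, weylPoint_rowShape])
  exact ⟨hbij.equiv _⟩

end Walks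

section LocalRules

open YoungDiagram

/-- `ν` is obtained from `μ` by adding a vertical strip, that is, at most one box in every row.
Stated on column lengths, this is the interlacing `ν'₁ ≥ μ'₁ ≥ ν'₂ ≥ μ'₂ ≥ ⋯`. These are the
pairs of neighbours in the growth diagrams below. -/
def IsVerticalStrip (μ ν : YoungDiagram) : Prop :=
  ∀ c, μ.colLen c ≤ ν.colLen c ∧ ν.colLen (c + 1) ≤ μ.colLen c

/-- The local rule of the dual Robinson–Schensted correspondence in a square with bottom-left
corner `ρ`, top-right corner `lam`, the two other corners `μ` and `ν`, and a cross of weight `x`.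
It is written without subtraction. -/
structure LocalRule (ρ μ ν lam : YoungDiagram) (x : ℕ) : Prop where
  zero : lam.colLen 0 = max (μ.colLen 0) (ν.colLen 0) + x
  succ : ∀ c, lam.colLen (c + 1) + ρ.colLen c =
    max (μ.colLen (c + 1)) (ν.colLen (c + 1)) + min (μ.colLen c) (ν.colLen c)

/-- The diagram `lam` determined by the local rule from `ρ`, `μ`, `ν` and the weight `x`. -/
noncomputable def grow (ρ μ ν : YoungDiagram) (x : ℕ) : YoungDiagram :=
  ofColLen fun
    | 0 => max (μ.colLen 0) (ν.colLen 0) + x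
    | c + 1 => max (μ.colLen (c + 1)) (ν.colLen (c + 1)) + min (μ.colLen c) (ν.colLen c) -
        ρ.colLen c

/-- The diagram `ρ` determined by the local rule from `μ`, `ν` and `lam`. -/
noncomputable def shrink (μ ν lam : YoungDiagram) : YoungDiagram :=
  ofColLen fun c =>
    max (μ.colLen (c + 1)) (ν.colLen (c + 1)) + min (μ.colLen c) (ν.colLen c) -
      lam.colLen (c + 1)

variable {ρ μ ν lam : YoungDiagram} {x : ℕ}

namespace IsVerticalStrip

theorem refl (μ : YoungDiagram) : IsVerticalStrip μ μ :=
  fun c => ⟨le_rfl, μ.colLen_anti _ _ c.le_succ⟩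

theorem le (h : IsVerticalStrip μ ν) : μ ≤ ν := le_iff_colLen_le.mpr fun c => (h c).1

theorem of_addBox (h : μ.AddBox ν) : IsVerticalStrip μ ν := by
  refine fun c => ⟨le_iff_colLen_le.mp (addBox_iff.mp h).1 c, ?_⟩
  obtain ⟨⟨i, d⟩, -, hν⟩ := h
  by_contra! hlt
  have hmem (j e : ℕ) : j < ν.colLen e ↔ (j = i ∧ e = d) ∨ j < μ.colLen e := by
    rw [← mem_iff_lt_colLen, ← mem_iff_lt_colLen, ← mem_cells, hν, mem_insert, Prod.mk.injEq,
      mem_cells]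
  have hν' := ν.colLen_anti _ _ (c.le_add_right 1)
  have hμ' := μ.colLen_anti _ _ (c.le_add_right 1)
  have := hmem (μ.colLen c) c
  have := hmem (μ.colLen c) (c + 1)
  omega

end IsVerticalStrip

theorem isVerticalStrip_rowShape {p q : ℕ} (hpq : p ≤ q) (hqp : q ≤ p + 1) :
    IsVerticalStrip (rowShape p) (rowShape q) := by
  intro c
  simp only [colLen_rowShape]
  split_ifs <;> omega

theorem isVerticalStrip_inf_of_addBox_or_addBox (h : μ.AddBox ν ∨ ν.AddBox μ) :
    IsVerticalStrip (μ ⊓ ν) μ ∧ IsVerticalStrip (μ ⊓ ν) ν := by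
  obtain h | h := h
  · rw [inf_eq_left.mpr (addBox_iff.mp h).1]
    exact ⟨.refl μ, .of_addBox h⟩
  · rw [inf_eq_right.mpr (addBox_iff.mp h).1]
    exact ⟨.of_addBox h, .refl ν⟩

theorem colLen_ofColLen_of_interlace {p q : ℕ → ℕ} (h : ∀ c, p (c + 1) ≤ q c ∧ q c ≤ p c)
    {N : ℕ} (hN : q N = 0) : (ofColLen p).colLen = p :=
  colLen_ofColLen (antitone_nat_of_succ_le fun c => (h c).1.trans (h c).2)
    (Nat.le_zero.mp ((h N).1.trans_eq hN))

theorem localRule_grow (hμ : IsVerticalStrip ρ μ) (hν : IsVerticalStrip ρ ν) (x : ℕ) :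
    LocalRule ρ μ ν (grow ρ μ ν x) x := by
  have hmax (c : ℕ) : max (μ.colLen (c + 1)) (ν.colLen (c + 1)) ≤ ρ.colLen c :=
    max_le (hμ c).2 (hν c).2
  have hmin (c : ℕ) : ρ.colLen c ≤ min (μ.colLen c) (ν.colLen c) := le_min (hμ c).1 (hν c).1
  have hcol : (grow ρ μ ν x).colLen = _ :=
    colLen_ofColLen_of_interlace (q := μ.colLen) (N := μ.rowLen 0) (fun c => by
      have := hmax c
      refine ⟨by dsimp only; omega, ?_⟩
      rcases c with _ | c
      · exact (le_max_left _ _).trans (Nat.le_add_right _ _)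
      · have := hmin c
        dsimp only
        omega) (colLen_eq_zero_iff.mpr le_rfl)
  refine ⟨by rw [hcol], fun c => ?_⟩
  rw [hcol]
  exact Nat.sub_add_cancel ((hmin c).trans (Nat.le_add_left _ _))

theorem localRule_shrink (hμ : IsVerticalStrip μ lam) (hν : IsVerticalStrip ν lam) :
    LocalRule (shrink μ ν lam) μ ν lam (lam.colLen 0 - max (μ.colLen 0) (ν.colLen 0)) := by
  have hmax (c : ℕ) : max (μ.colLen c) (ν.colLen c) ≤ lam.colLen c := max_le (hμ c).1 (hν c).1
  have hmin (c : ℕ) : lam.colLen (c + 1) ≤ min (μ.colLen c) (ν.colLen c) :=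
    le_min (hμ c).2 (hν c).2
  have hcol : (shrink μ ν lam).colLen = _ :=
    colLen_ofColLen_of_interlace (q := fun c => μ.colLen (c + 1)) (N := μ.rowLen 0) (fun c => by
      have := hmax (c + 1 + 1)
      have := hmin c
      omega) (colLen_eq_zero_iff.mpr (Nat.le_succ _))
  refine ⟨(Nat.add_sub_of_le (hmax 0)).symm, fun c => ?_⟩
  rw [hcol]
  exact Nat.add_sub_of_le ((hmin c).trans (Nat.le_add_left _ _))

namespace LocalRule

theorem symm (h : LocalRule ρ μ ν lam x) : LocalRule ρ ν μ lam x :=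
  ⟨by rw [h.zero, max_comm], fun c => by rw [h.succ, max_comm, min_comm]⟩

theorem isVerticalStrip_top (h : LocalRule ρ μ ν lam x) (hμ : IsVerticalStrip ρ μ)
    (hν : IsVerticalStrip ρ ν) : IsVerticalStrip μ lam := by
  intro c
  have := hμ c
  have := hν c
  have := h.succ c
  refine ⟨?_, by omega⟩
  rcases c with _ | c
  · have := h.zero
    omega
  · have := hμ c
    have := hν c
    have := h.succ c
    omega

theorem isVerticalStrip_bot (h : LocalRule ρ μ ν lam x) (hμ : IsVerticalStrip μ lam)
    (hν : IsVerticalStrip ν lam) : IsVerticalStrip ρ μ := by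
  intro c
  have := hμ c
  have := hν c
  have := hμ (c + 1)
  have := hν (c + 1)
  have := h.succ c
  omega

theorem top_unique {lam' : YoungDiagram} (h : LocalRule ρ μ ν lam x)
    (h' : LocalRule ρ μ ν lam' x) : lam = lam' :=
  colLen_injective <| funext fun
    | 0 => h.zero.trans h'.zero.symm
    | c + 1 => Nat.add_right_cancel ((h.succ c).trans (h'.succ c).symm)

theorem bot_unique {ρ' : YoungDiagram} {x' : ℕ} (h : LocalRule ρ μ ν lam x)
    (h' : LocalRule ρ' μ ν lam x') : ρ = ρ' :=
  colLen_injective <| funext fun c => Nat.add_left_cancel ((h.succ c).trans (h'.succ c).symm)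

theorem cross_unique {ρ' : YoungDiagram} {x' : ℕ} (h : LocalRule ρ μ ν lam x)
    (h' : LocalRule ρ' μ ν lam x') : x = x' :=
  Nat.add_left_cancel (h.zero.symm.trans h'.zero)

theorem card_add_card (h : LocalRule ρ μ ν lam x) : lam.card + ρ.card = μ.card + ν.card + x := by
  obtain ⟨N, hρ, hμ, hν, hlam⟩ : ∃ N, ρ.colLen N = 0 ∧ μ.colLen N = 0 ∧ ν.colLen N = 0 ∧
      lam.colLen (N + 1) = 0 := by
    refine ⟨ρ.rowLen 0 + μ.rowLen 0 + ν.rowLen 0 + lam.rowLen 0, ?_⟩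
    simp only [colLen_eq_zero_iff]
    omega
  have hmax : ∑ c ∈ range (N + 1), max (μ.colLen c) (ν.colLen c) =
      ∑ c ∈ range N, max (μ.colLen c) (ν.colLen c) := by
    rw [sum_range_succ, hμ, hν, max_self, add_zero]
  calc lam.card + ρ.card
      = ∑ c ∈ range N, (lam.colLen (c + 1) + ρ.colLen c) + lam.colLen 0 := by
        rw [card_eq_sum_colLen hlam, card_eq_sum_colLen hρ, sum_range_succ', sum_add_distrib]
        omega
    _ = ∑ c ∈ range (N + 1), max (μ.colLen c) (ν.colLen c) +
          ∑ c ∈ range N, min (μ.colLen c) (ν.colLen c) + x := by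
        rw [sum_congr rfl fun c _ => h.succ c, sum_add_distrib, h.zero, sum_range_succ']
        omega
    _ = μ.card + ν.card + x := by
        rw [hmax, ← sum_add_distrib, sum_congr rfl fun c _ => max_add_min _ _, sum_add_distrib,
          ← card_eq_sum_colLen hμ, ← card_eq_sum_colLen hν]

end LocalRule

end LocalRules

section Growth

/-- A growth diagram of size `n`: shapes `G i t` at the points `i + t ≤ n` of the quadrant, empty
for `i = 0`, with a cross of weight `x i t` in each unit square `[i, i + 1] × [t, t + 1]` below
the antidiagonal `i + t = n`. The values of `G` and `x` elsewhere carry no information. -/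
structure IsGrowth (n : ℕ) (G : ℕ → ℕ → YoungDiagram) (x : ℕ → ℕ → ℕ) : Prop where
  bot : ∀ t ≤ n, G 0 t = ⊥
  right : ∀ i t, i + t < n → IsVerticalStrip (G i t) (G (i + 1) t)
  up : ∀ i t, i + t < n → IsVerticalStrip (G i t) (G i (t + 1))
  rule : ∀ i t, i + t + 2 ≤ n →
    LocalRule (G i t) (G (i + 1) t) (G i (t + 1)) (G (i + 1) (t + 1)) (x i t)

/-- The shapes determined by the local rule from the crosses `x`, the shapes `A i` at the points
`(i, 0)` and empty shapes at the points `(0, t)`. -/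
noncomputable def growFrom (A : ℕ → YoungDiagram) (x : ℕ → ℕ → ℕ) : ℕ → ℕ → YoungDiagram
  | 0, _ => ⊥
  | i + 1, 0 => A (i + 1)
  | i + 1, t + 1 =>
    grow (growFrom A x i t) (growFrom A x (i + 1) t) (growFrom A x i (t + 1)) (x i t)

/-- The shapes determined by the local rule from two consecutive antidiagonals `τ` and `σ`:
`shrinkFrom τ σ d i` is the shape at the `i`-th point of the `d`-th antidiagonal below `τ`. -/
noncomputable def shrinkFrom (τ σ : ℕ → YoungDiagram) : ℕ → ℕ → YoungDiagram
  | 0, i => τ i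
  | 1, i => σ i
  | d + 2, i =>
    shrink (shrinkFrom τ σ (d + 1) (i + 1)) (shrinkFrom τ σ (d + 1) i) (shrinkFrom τ σ d (i + 1))

theorem growFrom_zero {A : ℕ → YoungDiagram} (hA : A 0 = ⊥) (x : ℕ → ℕ → ℕ) (i : ℕ) :
    growFrom A x i 0 = A i := by
  rcases i with _ | i
  · rw [growFrom, hA]
  · rw [growFrom]

theorem growFrom_succ_succ (A : ℕ → YoungDiagram) (x : ℕ → ℕ → ℕ) (i t : ℕ) :
    growFrom A x (i + 1) (t + 1) =
      grow (growFrom A x i t) (growFrom A x (i + 1) t) (growFrom A x i (t + 1)) (x i t) := by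
  rw [growFrom]

theorem isVerticalStrip_growFrom {A : ℕ → YoungDiagram} (hA : A 0 = ⊥)
    (hstrip : ∀ i, IsVerticalStrip (A i) (A (i + 1))) (x : ℕ → ℕ → ℕ) (i : ℕ) :
    ∀ t, IsVerticalStrip (growFrom A x i t) (growFrom A x (i + 1) t) ∧
      IsVerticalStrip (growFrom A x i t) (growFrom A x i (t + 1)) := by
  have right_of_up {i : ℕ}
      (hup : ∀ t, IsVerticalStrip (growFrom A x i t) (growFrom A x i (t + 1))) (t : ℕ) :
      IsVerticalStrip (growFrom A x i t) (growFrom A x (i + 1) t) := by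
    induction t with
    | zero => simpa only [growFrom_zero hA] using hstrip i
    | succ t ih =>
      rw [growFrom_succ_succ]
      exact (localRule_grow ih (hup t) (x i t)).symm.isVerticalStrip_top (hup t) ih
  have hup : ∀ t, IsVerticalStrip (growFrom A x i t) (growFrom A x i (t + 1)) := by
    induction i with
    | zero =>
      intro t
      simp only [growFrom]
      exact .refl ⊥
    | succ i ih =>
      intro t
      rw [growFrom_succ_succ]
      exact (localRule_grow (right_of_up ih t) (ih t) (x i t)).isVerticalStrip_top
        (right_of_up ih t) (ih t)
  exact fun t => ⟨right_of_up hup t, hup t⟩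

theorem isGrowth_growFrom {A : ℕ → YoungDiagram} (hA : A 0 = ⊥)
    (hstrip : ∀ i, IsVerticalStrip (A i) (A (i + 1))) (n : ℕ) (x : ℕ → ℕ → ℕ) :
    IsGrowth n (growFrom A x) x where
  bot t _ := by rw [growFrom]
  right i t _ := (isVerticalStrip_growFrom hA hstrip x i t).1
  up i t _ := (isVerticalStrip_growFrom hA hstrip x i t).2
  rule i t _ := by
    obtain ⟨hright, hup⟩ := isVerticalStrip_growFrom hA hstrip x i t
    rw [growFrom_succ_succ]
    exact localRule_grow hright hup (x i t)

theorem isVerticalStrip_shrinkFrom {τ σ : ℕ → YoungDiagram}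
    (hup : ∀ i, IsVerticalStrip (σ i) (τ i)) (hright : ∀ i, IsVerticalStrip (σ i) (τ (i + 1)))
    (d : ℕ) : ∀ i, IsVerticalStrip (shrinkFrom τ σ (d + 1) i) (shrinkFrom τ σ d (i + 1)) ∧
      IsVerticalStrip (shrinkFrom τ σ (d + 1) i) (shrinkFrom τ σ d i) := by
  induction d with
  | zero => exact fun i => ⟨hright i, hup i⟩
  | succ d ih =>
    intro i
    have hrule := localRule_shrink (ih (i + 1)).2 (ih i).1
    exact ⟨hrule.isVerticalStrip_bot (ih (i + 1)).2 (ih i).1,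
      hrule.symm.isVerticalStrip_bot (ih i).1 (ih (i + 1)).2⟩

theorem exists_isGrowth_of_antidiagonals (n : ℕ) {τ σ : ℕ → YoungDiagram} (hτ : τ 0 = ⊥)
    (hup : ∀ i, IsVerticalStrip (σ i) (τ i)) (hright : ∀ i, IsVerticalStrip (σ i) (τ (i + 1))) :
    ∃ G x, IsGrowth n G x ∧ (∀ i t, i + t = n → G i t = τ i) ∧
      ∀ i t, i + t + 1 = n → G i t = σ i := by
  let G (i t : ℕ) : YoungDiagram := shrinkFrom τ σ (n - (i + t)) i
  have hG {i t d : ℕ} (h : i + t + d = n) : G i t = shrinkFrom τ σ d i := by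
    simp only [G, ← h, Nat.add_sub_cancel_left]
  have hstrip := isVerticalStrip_shrinkFrom hup hright
  have hbot (d : ℕ) : shrinkFrom τ σ d 0 = ⊥ := by
    induction d with
    | zero => exact hτ
    | succ d ih => exact le_bot_iff.mp (ih ▸ (hstrip d 0).2.le)
  refine ⟨G, fun i t =>
    (G (i + 1) (t + 1)).colLen 0 - max ((G (i + 1) t).colLen 0) ((G i (t + 1)).colLen 0),
    ⟨fun t _ => hbot _, fun i t h => ?_, fun i t h => ?_, fun i t h => ?_⟩,
    fun i t h => hG (d := 0) h, fun i t h => hG (d := 1) h⟩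
  · obtain ⟨d, rfl⟩ := Nat.exists_eq_add_of_lt h
    rw [hG (d := d + 1) (by omega), hG (d := d) (by omega)]
    exact (hstrip d i).1
  · obtain ⟨d, rfl⟩ := Nat.exists_eq_add_of_lt h
    rw [hG (d := d + 1) (by omega), hG (d := d) (by omega)]
    exact (hstrip d i).2
  · obtain ⟨d, rfl⟩ := Nat.exists_eq_add_of_le h
    rw [hG (i := i) (t := t) (d := d + 2) (by omega),
      hG (i := i + 1) (t := t) (d := d + 1) (by omega),
      hG (i := i) (t := t + 1) (d := d + 1) (by omega),
      hG (i := i + 1) (t := t + 1) (d := d) (by omega)]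
    exact localRule_shrink (hstrip d (i + 1)).2 (hstrip d i).1

namespace IsGrowth

variable {n : ℕ} {G G' : ℕ → ℕ → YoungDiagram} {x x' : ℕ → ℕ → ℕ}

theorem eq_of_antidiagonals_eq (h : IsGrowth n G x) (h' : IsGrowth n G' x')
    (hτ : ∀ i t, i + t = n → G i t = G' i t) (hσ : ∀ i t, i + t + 1 = n → G i t = G' i t)
    {i t : ℕ} (hit : i + t ≤ n) : G i t = G' i t := by
  obtain ⟨d, hd⟩ := Nat.exists_eq_add_of_le hit
  induction d using Nat.twoStepInduction generalizing i t with
  | zero => exact hτ i t hd.symm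
  | one => exact hσ i t hd.symm
  | more d ih ih' =>
    have hrule := h.rule i t (by omega)
    rw [ih' (i := i + 1) (t := t) (by omega) (by omega),
      ih' (i := i) (t := t + 1) (by omega) (by omega),
      ih (i := i + 1) (t := t + 1) (by omega) (by omega)] at hrule
    exact hrule.bot_unique (h'.rule i t (by omega))

theorem cross_eq_of_antidiagonals_eq (h : IsGrowth n G x) (h' : IsGrowth n G' x')
    (hτ : ∀ i t, i + t = n → G i t = G' i t) (hσ : ∀ i t, i + t + 1 = n → G i t = G' i t)
    {i t : ℕ} (hit : i + t + 2 ≤ n) : x i t = x' i t := by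
  have hG {i t : ℕ} (hit : i + t ≤ n) : G i t = G' i t := h.eq_of_antidiagonals_eq h' hτ hσ hit
  have hrule := h.rule i t hit
  rw [hG (i := i + 1) (t := t) (by omega), hG (i := i) (t := t + 1) (by omega),
    hG (i := i + 1) (t := t + 1) (by omega)] at hrule
  exact hrule.cross_unique (h'.rule i t hit)

theorem eq_of_boundary_eq (h : IsGrowth n G x) (h' : IsGrowth n G' x)
    (hbdry : ∀ i ≤ n, G i 0 = G' i 0) {i t : ℕ} (hit : i + t ≤ n) : G i t = G' i t := by
  induction i generalizing t with
  | zero => rw [h.bot t (by omega), h'.bot t (by omega)]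
  | succ i ih =>
    induction t with
    | zero => exact hbdry _ hit
    | succ t iht =>
      have hrule := h.rule i t (by omega)
      rw [ih (t := t) (by omega), ih (t := t + 1) (by omega), iht (by omega)] at hrule
      exact hrule.top_unique (h'.rule i t (by omega))

theorem le_right (h : IsGrowth n G x) {i i' t : ℕ} (hi : i ≤ i') (hn : i' + t ≤ n) :
    G i t ≤ G i' t := by
  induction i', hi using Nat.le_induction with
  | base => exact le_rfl
  | succ i' _ ih => exact (ih (by omega)).trans (h.right i' t (by omega)).le

theorem le_up (h : IsGrowth n G x) {i t t' : ℕ} (ht : t ≤ t') (hn : i + t' ≤ n) :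
    G i t ≤ G i t' := by
  induction t', ht using Nat.le_induction with
  | base => exact le_rfl
  | succ t' _ ih => exact (ih (by omega)).trans (h.up i t' (by omega)).le

theorem mono (h : IsGrowth n G x) {i i' t t' : ℕ} (hi : i ≤ i') (ht : t ≤ t')
    (hn : i' + t' ≤ n) : G i t ≤ G i' t' :=
  (h.le_right hi (by omega)).trans (h.le_up ht hn)

theorem card_right (h : IsGrowth n G x) {i t : ℕ} (hit : i + t < n) :
    (G (i + 1) t).card + (G i 0).card =
      (G i t).card + (G (i + 1) 0).card + ∑ b ∈ range t, x i b := by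
  induction t with
  | zero => simp [add_comm]
  | succ t ih =>
    have := ih (by omega)
    have := (h.rule i t (by omega)).card_add_card
    rw [sum_range_succ]
    omega

theorem card_up (h : IsGrowth n G x) {i t : ℕ} (hit : i + t < n) :
    (G i (t + 1)).card = (G i t).card + ∑ a ∈ range i, x a t := by
  induction i with
  | zero => simp [h.bot t (by omega), h.bot (t + 1) (by omega)]
  | succ i ih =>
    have := ih (by omega)
    have := (h.rule i t (by omega)).card_add_card
    rw [sum_range_succ]
    omega

end IsGrowth

end Growth

section Weights

/-- Weights `a v` of the open arcs at the vertices `v < n` and `x i t` of the arcs from `i` to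
`n - 1 - t`, such that the total weight at every vertex is `1`. Right endpoints are counted from
the right so that the arc from `i` to `j` becomes the cross in column `i` and row `n - 1 - j` of
a growth diagram. -/
def IsMatchingWeight (n : ℕ) (a : ℕ → ℕ) (x : ℕ → ℕ → ℕ) : Prop :=
  ∀ i t, i + t + 1 = n → a i + ∑ s ∈ range t, x i s + ∑ j ∈ range i, x j t = 1

variable {n : ℕ} {a : ℕ → ℕ} {x : ℕ → ℕ → ℕ}

theorem IsMatchingWeight.le_one (h : IsMatchingWeight n a x) {i t : ℕ} (hit : i + t + 2 ≤ n) :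
    x i t ≤ 1 := by
  have hle := single_le_sum_of_canonicallyOrdered (f := x i)
    (mem_range.mpr (by omega : t < n - 1 - i))
  have := h i (n - 1 - i) (by omega)
  omega

theorem IsMatchingWeight.open_le_one (h : IsMatchingWeight n a x) {v : ℕ} (hv : v < n) :
    a v ≤ 1 := by
  have := h v (n - 1 - v) (by omega)
  omega

/-- The number of arcs in `A` from `i` to `n - 1 - t`. -/
def arcCount (A : Finset (Fin n × Fin n)) (i t : ℕ) : ℕ :=
  #{e ∈ A | (e.1 : ℕ) = i ∧ (e.2.rev : ℕ) = t}

/-- The number of elements of `O` with value `v`. -/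
def openCount (O : Finset (Fin n)) (v : ℕ) : ℕ := #{w ∈ O | Fin.val w = v}

variable {A : Finset (Fin n × Fin n)} {O : Finset (Fin n)}

theorem arcCount_eq_ite (A : Finset (Fin n × Fin n)) (e : Fin n × Fin n) :
    arcCount A e.1 e.2.rev = if e ∈ A then 1 else 0 := by
  simp only [arcCount, ← Fin.ext_iff, Fin.rev_inj, ← Prod.ext_iff, filter_eq', apply_ite card,
    card_singleton, card_empty]

theorem openCount_eq_ite (O : Finset (Fin n)) (v : Fin n) :
    openCount O v = if v ∈ O then 1 else 0 := by
  simp only [openCount, ← Fin.ext_iff, filter_eq', apply_ite card, card_singleton, card_empty]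

theorem openCount_le_one (O : Finset (Fin n)) (v : ℕ) : openCount O v ≤ 1 :=
  card_le_one.mpr fun _ hu _ hw =>
    Fin.ext ((mem_filter.mp hu).2.trans (mem_filter.mp hw).2.symm)

theorem sum_openCount (O : Finset (Fin n)) (v : ℕ) :
    ∑ w ∈ range v, openCount O w = #{w ∈ O | Fin.val w < v} := by
  rw [card_eq_sum_card_fiberwise (f := Fin.val) (t := range v) (by intro w; simp)]
  refine sum_congr rfl fun w hw => ?_
  rw [openCount, filter_filter]
  refine congrArg card (filter_congr fun u _ => ?_)
  have := mem_range.mp hw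
  omega

theorem sum_arcCount_left (hA : ∀ e ∈ A, e.1 < e.2) (v : Fin n) :
    ∑ t ∈ range v.rev, arcCount A v t = #{e ∈ A | e.1 = v} := by
  rw [card_eq_sum_card_fiberwise (f := fun e => (e.2.rev : ℕ)) (t := range v.rev)]
  · simp only [arcCount, filter_filter, Fin.ext_iff]
  · intro e he
    obtain ⟨heA, rfl⟩ := mem_filter.mp he
    exact mem_coe.mpr (mem_range.mpr (Fin.rev_lt_rev.mpr (hA e heA)))

theorem sum_arcCount_right (hA : ∀ e ∈ A, e.1 < e.2) (v : Fin n) :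
    ∑ i ∈ range v, arcCount A i v.rev = #{e ∈ A | e.2 = v} := by
  rw [card_eq_sum_card_fiberwise (f := fun e => (e.1 : ℕ)) (t := range v)]
  · simp only [arcCount, filter_filter, ← Fin.ext_iff, Fin.rev_inj, and_comm]
  · intro e he
    obtain ⟨heA, rfl⟩ := mem_filter.mp he
    exact mem_coe.mpr (mem_range.mpr (hA e heA))

theorem incidence_iff (hA : ∀ e ∈ A, e.1 < e.2) (v : Fin n) :
    ((v ∉ O ∧ ∃! e, e ∈ A ∧ (e.1 = v ∨ e.2 = v)) ∨ (v ∈ O ∧ ∀ e ∈ A, e.1 ≠ v ∧ e.2 ≠ v)) ↔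
      openCount O v + ∑ t ∈ range v.rev, arcCount A v t + ∑ i ∈ range v, arcCount A i v.rev
        = 1 := by
  have hdisj : Disjoint {e ∈ A | e.1 = v} {e ∈ A | e.2 = v} :=
    disjoint_filter.mpr fun e he h1 h2 => (hA e he).ne (h1.trans h2.symm)
  have hunique : (∃! e, e ∈ A ∧ (e.1 = v ∨ e.2 = v)) ↔ #{e ∈ A | e.1 = v ∨ e.2 = v} = 1 := by
    simp only [card_eq_one_iff_existsUnique, mem_filter]
  have hnone : (∀ e ∈ A, e.1 ≠ v ∧ e.2 ≠ v) ↔ #{e ∈ A | e.1 = v ∨ e.2 = v} = 0 := by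
    simp only [card_eq_zero, filter_eq_empty_iff, not_or, ne_eq]
  rw [sum_arcCount_left hA, sum_arcCount_right hA, add_assoc, ← card_union_of_disjoint hdisj,
    ← filter_or, openCount_eq_ite, hunique, hnone]
  split_ifs with hv <;> simp [hv]

namespace OpenMatching

theorem isMatchingWeight (D : OpenMatching n) :
    IsMatchingWeight n (openCount D.openArcs) (arcCount D.arcs) := by
  intro i t hit
  have hrev : ((⟨i, by omega⟩ : Fin n).rev : ℕ) = t := by
    simp only [Fin.val_rev]
    omega
  have := (incidence_iff D.lt_of_mem ⟨i, by omega⟩).mp (D.incidence ⟨i, by omega⟩)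
  rwa [hrev] at this

theorem eq_of_counts_eq {D E : OpenMatching n}
    (hopen : ∀ v < n, openCount D.openArcs v = openCount E.openArcs v)
    (harcs : ∀ i t, i + t + 2 ≤ n → arcCount D.arcs i t = arcCount E.arcs i t) : D = E := by
  have hmem {e : Fin n × Fin n} (he : e.1 < e.2) : e ∈ D.arcs ↔ e ∈ E.arcs := by
    have := harcs e.1 e.2.rev (by rw [Fin.val_rev]; omega)
    rw [arcCount_eq_ite, arcCount_eq_ite] at this
    split_ifs at this <;> simp_all
  ext e
  · exact ⟨fun he => (hmem (D.lt_of_mem e he)).mp he, fun he => (hmem (E.lt_of_mem e he)).mpr he⟩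
  · have := hopen e e.2
    rw [openCount_eq_ite, openCount_eq_ite] at this
    split_ifs at this <;> simp_all

theorem exists_of_isMatchingWeight (h : IsMatchingWeight n a x) :
    ∃ D : OpenMatching n, (∀ v < n, openCount D.openArcs v = a v) ∧
      ∀ i t, i + t + 2 ≤ n → arcCount D.arcs i t = x i t := by
  let A : Finset (Fin n × Fin n) := {e | e.1 < e.2 ∧ x e.1 e.2.rev = 1}
  let O : Finset (Fin n) := {v | a v = 1}
  have hA : ∀ e ∈ A, e.1 < e.2 := fun e he => (mem_filter.mp he).2.1
  have hopen (v : ℕ) (hv : v < n) : openCount O v = a v := by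
    have := h.open_le_one hv
    rw [show v = (⟨v, hv⟩ : Fin n) from rfl, openCount_eq_ite]
    simp only [O, mem_filter, mem_univ, true_and]
    split_ifs <;> omega
  have harcs (i t : ℕ) (hit : i + t + 2 ≤ n) : arcCount A i t = x i t := by
    have := h.le_one hit
    obtain ⟨e, rfl, rfl⟩ : ∃ e : Fin n × Fin n, (e.1 : ℕ) = i ∧ (e.2.rev : ℕ) = t :=
      ⟨(⟨i, by omega⟩, Fin.rev ⟨t, by omega⟩), rfl, by rw [Fin.rev_rev]⟩
    have he : e.1 < e.2 := by
      rw [Fin.val_rev] at hit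
      omega
    rw [arcCount_eq_ite]
    simp only [A, mem_filter, mem_univ, true_and, he]
    split_ifs <;> omega
  refine ⟨⟨A, O, hA, fun v => (incidence_iff hA v).mpr ?_⟩, hopen, harcs⟩
  rw [hopen v v.2, sum_congr rfl fun t ht => harcs v t ?_,
    sum_congr rfl fun i hi => harcs i v.rev ?_]
  · exact h v v.rev (by rw [Fin.val_rev]; omega)
  · have := mem_range.mp hi
    rw [Fin.val_rev]
    omega
  · have := mem_range.mp ht
    rw [Fin.val_rev] at this
    omega

end OpenMatching

end Weights

section RowBoundary

/-- The shapes of `G` along the axis `t = 0` are rows, and the row grows by `a v` boxes between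
`(v, 0)` and `(v + 1, 0)`. -/
def HasRowBoundary (n : ℕ) (G : ℕ → ℕ → YoungDiagram) (a : ℕ → ℕ) : Prop :=
  ∀ i ≤ n, G i 0 = rowShape (∑ v ∈ range i, a v)

variable {n : ℕ} {G G' : ℕ → ℕ → YoungDiagram} {a a' : ℕ → ℕ} {x : ℕ → ℕ → ℕ} {i t : ℕ}

theorem HasRowBoundary.card (hb : HasRowBoundary n G a) {i : ℕ} (hi : i ≤ n) :
    (G i 0).card = ∑ v ∈ range i, a v := by
  rw [hb i hi, card_rowShape]

theorem HasRowBoundary.card_succ (hb : HasRowBoundary n G a) (hi : i < n) :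
    (G (i + 1) 0).card = (G i 0).card + a i := by
  rw [hb.card hi, hb.card hi.le, sum_range_succ]

theorem hasRowBoundary_unique (hb : HasRowBoundary n G a) (hb' : HasRowBoundary n G' a')
    (hG : ∀ i ≤ n, G i 0 = G' i 0) {v : ℕ} (hv : v < n) : a v = a' v := by
  have hcard := hb.card_succ hv
  rw [hG v hv.le, hG (v + 1) hv, hb'.card_succ hv] at hcard
  exact (Nat.add_left_cancel hcard).symm

namespace IsGrowth

theorem card_add_card_eq_iff (h : IsGrowth n G x) (hb : HasRowBoundary n G a)
    (hit : i + t + 1 = n) :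
    (G (i + 1) t).card + (G i (t + 1)).card = 2 * (G i t).card + 1 ↔
      a i + ∑ s ∈ range t, x i s + ∑ j ∈ range i, x j t = 1 := by
  have := h.card_right (i := i) (t := t) (by omega)
  have := h.card_up (i := i) (t := t) (by omega)
  have := hb.card_succ (i := i) (by omega)
  omega

theorem exists_hasRowBoundary (h : IsGrowth n G x) {m : ℕ} (hm : G n 0 = rowShape m) :
    ∃ a, HasRowBoundary n G a := by
  refine ⟨fun v => (G (v + 1) 0).card - (G v 0).card, fun i hi => ?_⟩
  have hsum : ∑ v ∈ range i, ((G (v + 1) 0).card - (G v 0).card) = (G i 0).card := by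
    induction i with
    | zero => simp [h.bot 0 n.zero_le, YoungDiagram.card]
    | succ i ih =>
      have := card_le_card_of_le (h.right i 0 hi).le
      rw [sum_range_succ, ih (by omega)]
      omega
  rw [hsum]
  exact eq_rowShape_card_of_le (hm ▸ h.le_right hi le_rfl)

theorem eq_inf (h : IsGrowth n G x) (hb : HasRowBoundary n G a) (hw : IsMatchingWeight n a x)
    (hit : i + t + 1 = n) : G i t = G (i + 1) t ⊓ G i (t + 1) :=
  eq_inf_of_card_add_card (h.right i t (by omega)).le (h.up i t (by omega)).le
    ((h.card_add_card_eq_iff hb hit).mpr (hw i t hit))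

theorem eq_of_cross_ne_zero (h : IsGrowth n G x) (hb : HasRowBoundary n G a)
    (hw : IsMatchingWeight n a x) (hit : i + t + 2 ≤ n) (hx : x i t ≠ 0) :
    G (i + 1) t = G i t ∧ G i (t + 1) = G i t := by
  have hrow : ∑ s ∈ range (t + 1), x i s ≤ ∑ s ∈ range (n - 1 - i), x i s :=
    sum_le_sum_of_subset (range_subset_range.mpr (by omega))
  have hcol : ∑ j ∈ range (i + 1), x j t ≤ ∑ j ∈ range (n - 1 - t), x j t :=
    sum_le_sum_of_subset (range_subset_range.mpr (by omega))
  rw [sum_range_succ] at hrow hcol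
  have := hw i (n - 1 - i) (by omega)
  have := hw (n - 1 - t) t (by omega)
  have := h.card_right (i := i) (t := t) (by omega)
  have := h.card_up (i := i) (t := t) (by omega)
  have := hb.card_succ (i := i) (by omega)
  exact ⟨(eq_of_le_of_card_le (h.right i t (by omega)).le (by omega)).symm,
    (eq_of_le_of_card_le (h.up i t (by omega)).le (by omega)).symm⟩

end IsGrowth

end RowBoundary

section Nestings

theorem strictMono_snoc {α : Type*} [Preorder α] {r : ℕ} {f : Fin r → α} {y : α}
    (hf : StrictMono f) (hy : ∀ a, f a < y) : StrictMono (Fin.snoc f y : Fin (r + 1) → α) := by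
  intro a b hab
  obtain ⟨a, rfl⟩ := Fin.exists_castSucc_eq.mpr (hab.trans_le b.le_last).ne
  induction b using Fin.lastCases with
  | last => simpa only [Fin.snoc_castSucc, Fin.snoc_last] using hy a
  | cast b => simpa only [Fin.snoc_castSucc] using hf (Fin.castSucc_lt_castSucc_iff.mp hab)

namespace OpenMatching

variable {n : ℕ} {D : OpenMatching n} {lo r s i t : ℕ}

theorem isNesting_iff {f g : Fin r → Fin n} :
    D.IsNesting f g ↔ (∀ a, (f a, g a) ∈ D.arcs) ∧ StrictMono f ∧ StrictAnti g := by
  refine ⟨fun h => ⟨h.1, h.2.1, h.2.2.1⟩, fun ⟨hmem, hf, hg⟩ => ⟨hmem, hf, hg, fun a b => ?_⟩⟩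
  obtain hab | hba := le_total a b
  · exact (hf.monotone hab).trans_lt (D.lt_of_mem _ (hmem b))
  · exact (D.lt_of_mem _ (hmem a)).trans_le (hg.antitone hba)

theorem HasNesting.mono (h : D.HasNesting s) (hrs : r ≤ s) : D.HasNesting r := by
  obtain ⟨f, g, hfg⟩ := h
  obtain ⟨hmem, hf, hg⟩ := isNesting_iff.mp hfg
  exact ⟨f ∘ Fin.castLE hrs, g ∘ Fin.castLE hrs, isNesting_iff.mpr ⟨fun a => hmem _,
    hf.comp (Fin.strictMono_castLE hrs), hg.comp_strictMono (Fin.strictMono_castLE hrs)⟩⟩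

/-- `D` has an `r`-nesting with left endpoints in `[lo, i)` and right endpoints among the last `t`
vertices, that is, a chain of `r` crosses in the rectangle `[lo, i] × [0, t]` of the growth
diagram. -/
def HasNestingIn (D : OpenMatching n) (lo r i t : ℕ) : Prop :=
  ∃ f g : Fin r → Fin n, D.IsNesting f g ∧ ∀ a, lo ≤ f a ∧ (f a : ℕ) < i ∧ ((g a).rev : ℕ) < t

namespace HasNestingIn

theorem zero (D : OpenMatching n) (lo i t : ℕ) : D.HasNestingIn lo 0 i t :=
  ⟨Fin.elim0, Fin.elim0, isNesting_iff.mpr ⟨fun a => a.elim0, fun a => a.elim0, fun a => a.elim0⟩,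
    fun a => a.elim0⟩

theorem mono {i' t' : ℕ} (h : D.HasNestingIn lo r i t) (hi : i ≤ i') (ht : t ≤ t') :
    D.HasNestingIn lo r i' t' := by
  obtain ⟨f, g, hfg, hbox⟩ := h
  exact ⟨f, g, hfg, fun a => ⟨(hbox a).1, (hbox a).2.1.trans_le hi, (hbox a).2.2.trans_le ht⟩⟩

theorem exists_innermost (h : D.HasNestingIn lo (r + 1) i t) :
    ∃ e ∈ D.arcs, (e.1 : ℕ) < i ∧ (e.2.rev : ℕ) < t ∧ lo ≤ e.1 ∧
      D.HasNestingIn lo r e.1 e.2.rev := by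
  obtain ⟨f, g, hfg, hbox⟩ := h
  obtain ⟨hmem, hf, hg⟩ := isNesting_iff.mp hfg
  refine ⟨_, hmem (Fin.last r), (hbox _).2.1, (hbox _).2.2, (hbox _).1, f ∘ Fin.castSucc,
    g ∘ Fin.castSucc, isNesting_iff.mpr ⟨fun a => hmem _, hf.comp Fin.strictMono_castSucc,
      hg.comp_strictMono Fin.strictMono_castSucc⟩, fun a => ⟨(hbox _).1, ?_, ?_⟩⟩
  · exact hf a.castSucc_lt_last
  · exact Fin.rev_lt_rev.mpr (hg a.castSucc_lt_last)

theorem snoc {e : Fin n × Fin n} (he : e ∈ D.arcs) (hlo : lo ≤ e.1)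
    (h : D.HasNestingIn lo r e.1 e.2.rev) :
    D.HasNestingIn lo (r + 1) (e.1 + 1) (e.2.rev + 1) := by
  obtain ⟨f, g, hfg, hbox⟩ := h
  obtain ⟨hmem, hf, hg⟩ := isNesting_iff.mp hfg
  have hfe (a : Fin r) : f a < e.1 := (hbox a).2.1
  have hge (a : Fin r) : e.2 < g a := Fin.rev_lt_rev.mp (hbox a).2.2
  refine ⟨Fin.snoc f e.1, Fin.snoc g e.2, isNesting_iff.mpr ⟨?_, ?_, ?_⟩, ?_⟩
  · intro a
    induction a using Fin.lastCases with
    | last => simpa using he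
    | cast a => simpa using hmem a
  · exact strictMono_snoc hf hfe
  · exact strictMono_snoc (α := (Fin n)ᵒᵈ) hg hge
  · intro a
    induction a using Fin.lastCases with
    | last => simpa using hlo
    | cast a =>
      have := hbox a
      simp only [Fin.snoc_castSucc]
      omega

end HasNestingIn

theorem IsNesting.exists_hasNestingIn {f g : Fin r → Fin n} (h : D.IsNesting f g)
    (hlo : lo ≤ n) (hf : ∀ a, lo ≤ f a) : ∃ i t, lo ≤ i ∧ i + t = n ∧ D.HasNestingIn lo r i t := by
  rcases r with _ | r
  · exact ⟨lo, n - lo, le_rfl, Nat.add_sub_of_le hlo, .zero D _ _ _⟩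
  · have hlast := hf (Fin.last r)
    refine ⟨f (Fin.last r) + 1, n - (f (Fin.last r) + 1), by omega, by omega, f, g, h,
      fun a => ⟨hf a, ?_, ?_⟩⟩
    · exact Nat.lt_succ_of_le (h.2.1.monotone a.le_last)
    · have := h.2.2.2 (Fin.last r) a
      rw [Fin.val_rev]
      omega

end OpenMatching

namespace IsGrowth

variable {n : ℕ} {G : ℕ → ℕ → YoungDiagram} {D : OpenMatching n}

theorem add_le_colLen_of_hasNestingIn (h : IsGrowth n G (arcCount D.arcs)) {lo r i t : ℕ}
    (hlo : lo ≤ i) (hit : i + t ≤ n) (hr : D.HasNestingIn lo r i t) :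
    (G lo 0).colLen 0 + r ≤ (G i t).colLen 0 := by
  induction r generalizing i t with
  | zero => exact le_iff_colLen_le.mp (h.mono hlo t.zero_le hit) 0
  | succ r ih =>
    obtain ⟨e, he, hei, het, hlo', hnest⟩ := hr.exists_innermost
    have hcross := (h.rule e.1 e.2.rev (by omega)).zero
    rw [arcCount_eq_ite, if_pos he] at hcross
    have := le_iff_colLen_le.mp (h.mono (i := e.1) (t := e.2.rev)
      (Nat.le_add_right _ 1) le_rfl (by omega)) 0
    have := le_iff_colLen_le.mp (h.mono (i := e.1 + 1) (t := e.2.rev + 1) hei het hit) 0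
    have := ih hlo' (by omega) hnest
    omega

theorem exists_colLen_le_of_hasNestingIn (h : IsGrowth n G (arcCount D.arcs))
    (hb : HasRowBoundary n G (openCount D.openArcs)) {i t : ℕ} (hit : i + t ≤ n) :
    ∃ lo ≤ i, ∃ r, D.HasNestingIn lo r i t ∧ (G i t).colLen 0 ≤ (G lo 0).colLen 0 + r := by
  induction i generalizing t with
  | zero => exact ⟨0, le_rfl, 0, .zero D _ _ _, by simp [h.bot t (by omega), h.bot 0 n.zero_le]⟩
  | succ i ihi =>
    induction t with
    | zero => exact ⟨i + 1, le_rfl, 0, .zero D _ _ _, le_rfl⟩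
    | succ t iht =>
      have hcross := (h.rule i t (by omega)).zero
      by_cases hx : arcCount D.arcs i t = 0
      · rw [hx, add_zero] at hcross
        obtain hle | hle : (G (i + 1) (t + 1)).colLen 0 ≤ (G (i + 1) t).colLen 0 ∨
            (G (i + 1) (t + 1)).colLen 0 ≤ (G i (t + 1)).colLen 0 := by omega
        · obtain ⟨lo, hlo, r, hr, hcol⟩ := iht (by omega)
          exact ⟨lo, hlo, r, hr.mono le_rfl t.le_succ, hle.trans hcol⟩
        · obtain ⟨lo, hlo, r, hr, hcol⟩ := ihi (t := t + 1) (by omega)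
          exact ⟨lo, hlo.trans i.le_succ, r, hr.mono i.le_succ le_rfl, hle.trans hcol⟩
      · obtain ⟨hright, hup⟩ := h.eq_of_cross_ne_zero hb D.isMatchingWeight (by omega) hx
        rw [hright, hup, max_self] at hcross
        obtain ⟨e, he⟩ := card_ne_zero.mp hx
        obtain ⟨heD, rfl, rfl⟩ := mem_filter.mp he
        rw [arcCount_eq_ite, if_pos heD] at hcross
        obtain ⟨lo, hlo, r, hr, hcol⟩ := ihi (t := e.2.rev) (by omega)
        exact ⟨lo, hlo.trans (Nat.le_succ _), r + 1, .snoc heD hlo hr, by omega⟩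

theorem lt_colLen_iff (h : IsGrowth n G (arcCount D.arcs))
    (hb : HasRowBoundary n G (openCount D.openArcs)) (k : ℕ) :
    (∃ i t, i + t = n ∧ k < (G i t).colLen 0) ↔
      D.HasNesting (k + 1) ∨ D.HasFutureNesting (k + 1) := by
  have hbdry {lo : ℕ} (hlo : lo ≤ n) :
      (G lo 0).colLen 0 = if ∃ v ∈ D.openArcs, (v : ℕ) < lo then 1 else 0 := by
    simp only [hb lo hlo, colLen_rowShape, sum_openCount, card_pos, filter_nonempty_iff]
  constructor
  · rintro ⟨i, t, hit, hk⟩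
    obtain ⟨lo, hlo, r, ⟨f, g, hfg, hbox⟩, hcol⟩ := h.exists_colLen_le_of_hasNestingIn hb hit.le
    rw [hbdry (by omega)] at hcol
    by_cases hr : k + 1 ≤ r
    · exact Or.inl (.mono ⟨f, g, hfg⟩ hr)
    · split_ifs at hcol with hv
      · obtain ⟨v, hv, hvlo⟩ := hv
        obtain rfl : r = k := by omega
        exact Or.inr ⟨r, rfl, v, hv, f, g, hfg, fun a => hvlo.trans_le (hbox a).1⟩
      · omega
  · rintro (⟨f, g, hfg⟩ | ⟨s, hs, v, hv, f, g, hfg, hvf⟩)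
    · obtain ⟨i, t, hlo, hit, hnest⟩ := hfg.exists_hasNestingIn n.zero_le fun a => Nat.zero_le _
      have := h.add_le_colLen_of_hasNestingIn hlo hit.le hnest
      exact ⟨i, t, hit, by omega⟩
    · obtain rfl : k = s := by omega
      obtain ⟨i, t, hlo, hit, hnest⟩ := hfg.exists_hasNestingIn (lo := v + 1) v.2 hvf
      have := h.add_le_colLen_of_hasNestingIn hlo hit.le hnest
      rw [hbdry (by omega), if_pos ⟨v, hv, v.1.lt_succ_self⟩] at this
      exact ⟨i, t, hit, by omega⟩

end IsGrowth

end Nestings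

section Bijection

variable {n : ℕ} {t u : Fin (n + 1) → YoungDiagram} {D E : OpenMatching n}

/-- The sequence of shapes `t` is read off the antidiagonal `i + t = n` of the growth diagram
with a cross for every arc of `D` and a row along the axis that grows at the open arcs of `D`. -/
def Corresponds (t : Fin (n + 1) → YoungDiagram) (D : OpenMatching n) : Prop :=
  ∃ G, IsGrowth n G (arcCount D.arcs) ∧ HasRowBoundary n G (openCount D.openArcs) ∧
    ∀ s : Fin (n + 1), t s = G s (n - s)

namespace Corresponds

theorem first_eq_bot (h : Corresponds t D) : t 0 = ⊥ := by
  obtain ⟨G, hG, -, ht⟩ := h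
  exact (ht 0).trans (hG.bot n le_rfl)

theorem last_eq_rowShape (h : Corresponds t D) : t (Fin.last n) = rowShape #D.openArcs := by
  obtain ⟨G, -, hb, ht⟩ := h
  rw [ht, Fin.val_last, Nat.sub_self, hb n le_rfl, sum_openCount,
    filter_true_of_mem fun w _ => w.2]

theorem addBox_or_addBox (h : Corresponds t D) (s : Fin n) :
    (t s.castSucc).AddBox (t s.succ) ∨ (t s.succ).AddBox (t s.castSucc) := by
  obtain ⟨G, hG, hb, ht⟩ := h
  obtain ⟨r, hr⟩ := Nat.exists_eq_add_of_lt s.2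
  have hcard := (hG.card_add_card_eq_iff hb hr.symm).mpr (D.isMatchingWeight s r hr.symm)
  rw [ht, ht, Fin.val_castSucc, Fin.val_succ, show n - s = r + 1 by omega,
    show n - (s + 1) = r by omega, or_comm, addBox_or_addBox_iff,
    ← hG.eq_inf hb D.isMatchingWeight hr.symm]
  exact hcard

theorem height_le_iff (h : Corresponds t D) (k : ℕ) :
    (∀ s, (t s).colLen 0 ≤ k) ↔ ¬ D.HasNesting (k + 1) ∧ ¬ D.HasFutureNesting (k + 1) := by
  obtain ⟨G, hG, hb, ht⟩ := h
  rw [← not_or, ← hG.lt_colLen_iff hb]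
  push Not
  refine ⟨fun hk i r hir => ?_, fun hk s => ?_⟩
  · have := hk ⟨i, by omega⟩
    rwa [ht, show n - (⟨i, _⟩ : Fin (n + 1)).1 = r by dsimp only; omega] at this
  · rw [ht]
    exact hk _ _ (by omega)

theorem tableau_unique (h : Corresponds t D) (h' : Corresponds u D) : t = u := by
  obtain ⟨G, hG, hb, ht⟩ := h
  obtain ⟨G', hG', hb', hu⟩ := h'
  funext s
  rw [ht, hu]
  exact hG.eq_of_boundary_eq hG' (fun i hi => (hb i hi).trans (hb' i hi).symm) (by omega)

theorem matching_unique (h : Corresponds t D) (h' : Corresponds t E) : D = E := by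
  obtain ⟨G, hG, hb, ht⟩ := h
  obtain ⟨G', hG', hb', ht'⟩ := h'
  have hτ (i r : ℕ) (hir : i + r = n) : G i r = G' i r := by
    have := (ht ⟨i, by omega⟩).symm.trans (ht' ⟨i, by omega⟩)
    rwa [show n - (⟨i, _⟩ : Fin (n + 1)).1 = r by dsimp only; omega] at this
  have hσ (i r : ℕ) (hir : i + r + 1 = n) : G i r = G' i r := by
    rw [hG.eq_inf hb D.isMatchingWeight hir, hG'.eq_inf hb' E.isMatchingWeight hir,
      hτ (i + 1) r (by omega), hτ i (r + 1) hir]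
  exact OpenMatching.eq_of_counts_eq
    (fun v => hasRowBoundary_unique hb hb' fun i hi => hG.eq_of_antidiagonals_eq hG' hτ hσ hi)
    fun i r => hG.cross_eq_of_antidiagonals_eq hG' hτ hσ

theorem exists_tableau (D : OpenMatching n) : ∃ t, Corresponds t D := by
  let A (i : ℕ) : YoungDiagram := rowShape (∑ v ∈ range i, openCount D.openArcs v)
  have hstrip (i : ℕ) : IsVerticalStrip (A i) (A (i + 1)) := by
    refine isVerticalStrip_rowShape ?_ ?_ <;> rw [sum_range_succ]
    · exact Nat.le_add_right _ _
    · exact Nat.add_le_add_left (openCount_le_one _ i) _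
  have hA : A 0 = ⊥ := rowShape_zero
  exact ⟨_, _, isGrowth_growFrom hA hstrip n _, fun i _ => growFrom_zero hA _ i, fun s => rfl⟩

theorem exists_matching {m : ℕ} (h0 : t 0 = ⊥)
    (hstep : ∀ s : Fin n, (t s.castSucc).AddBox (t s.succ) ∨ (t s.succ).AddBox (t s.castSucc))
    (hm : t (Fin.last n) = rowShape m) : ∃ D, Corresponds t D := by
  let τ (i : ℕ) : YoungDiagram := t ⟨min i n, by omega⟩
  have hτ {s : Fin (n + 1)} {i : ℕ} (h : s = i) : τ i = t s :=
    congrArg t (Fin.ext (by dsimp only; omega))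
  have hadd {i : ℕ} (hi : i < n) : (τ i).AddBox (τ (i + 1)) ∨ (τ (i + 1)).AddBox (τ i) := by
    have := hstep ⟨i, hi⟩
    rwa [← hτ (i := i) rfl, ← hτ (i := i + 1) rfl] at this
  have hstrip (i : ℕ) : IsVerticalStrip (τ i ⊓ τ (i + 1)) (τ i) ∧
      IsVerticalStrip (τ i ⊓ τ (i + 1)) (τ (i + 1)) := by
    obtain hi | hi := lt_or_ge i n
    · exact isVerticalStrip_inf_of_addBox_or_addBox (hadd hi)
    · rw [show τ (i + 1) = τ i from congrArg t (Fin.ext (by dsimp only; omega)), inf_idem]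
      exact ⟨.refl _, .refl _⟩
  obtain ⟨G, x, hG, hGτ, hGσ⟩ := exists_isGrowth_of_antidiagonals n ((hτ rfl).trans h0)
    (fun i => (hstrip i).1) fun i => (hstrip i).2
  obtain ⟨a, hb⟩ := hG.exists_hasRowBoundary ((hGτ n 0 rfl).trans ((hτ rfl).trans hm))
  have hw : IsMatchingWeight n a x := fun i r hir => by
    rw [← hG.card_add_card_eq_iff hb hir, hGσ i r hir, hGτ (i + 1) r (by omega),
      hGτ i (r + 1) hir, add_comm]
    exact addBox_or_addBox_iff.mp (hadd (by omega))
  obtain ⟨D, hopen, harcs⟩ := OpenMatching.exists_of_isMatchingWeight hw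
  refine ⟨D, G, ⟨hG.bot, hG.right, hG.up, fun i r hir => harcs i r hir ▸ hG.rule i r hir⟩,
    fun i hi => ?_, fun s => ?_⟩
  · rw [hb i hi, sum_congr rfl fun v hv => hopen v ((mem_range.mp hv).trans_le hi)]
  · rw [hGτ s _ (by omega), hτ rfl]

end Corresponds

theorem nonempty_tableaux_equiv_matchings (n k m : ℕ) :
    Nonempty (oscillatingTableaux n k m ≃ nonnestingOpenMatchings n k m) := by
  have hex : ∀ t : oscillatingTableaux n k m, ∃ D : nonnestingOpenMatchings n k m,
      Corresponds t.1 D.1 := by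
    rintro ⟨t, hfirst, hstep, hk, hlast⟩
    obtain ⟨D, hD⟩ := Corresponds.exists_matching hfirst hstep hlast
    have hopen : #D.openArcs = m := rowShape_injective (hD.last_eq_rowShape.symm.trans hlast)
    exact ⟨⟨D, hopen, (hD.height_le_iff k).mp hk⟩, hD⟩
  choose f hf using hex
  refine ⟨Equiv.ofBijective f ⟨fun t u h => Subtype.ext ?_, ?_⟩⟩
  · exact (hf t).tableau_unique (h ▸ hf u)
  · rintro ⟨D, hopen, hnest⟩
    obtain ⟨t, ht⟩ := Corresponds.exists_tableau D
    have hmem : t ∈ oscillatingTableaux n k m := ⟨ht.first_eq_bot, ht.addBox_or_addBox,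
      (ht.height_le_iff k).mpr hnest, by rw [ht.last_eq_rowShape, hopen]⟩
    exact ⟨⟨t, hmem⟩, Subtype.ext ((hf _).matching_unique ht)⟩

end Bijection

theorem theorem3 (n k m : ℕ) :
    Nonempty (oscillatingTableaux n k m ≃ nonnestingOpenMatchings n k m) ∧
    (1 ≤ k ∨ m = 0 →
      Nonempty (oscillatingTableaux n k m ≃ oscillatingWalks n k (rowPoint k m)) ∧
      Nonempty (oscillatingWalks n k (rowPoint k m) ≃ nonnestingOpenMatchings n k m)) := by
  obtain ⟨e⟩ := nonempty_tableaux_equiv_matchings n k m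
  refine ⟨⟨e⟩, fun hkm => ?_⟩
  obtain ⟨e'⟩ := nonempty_tableaux_equiv_walks n hkm
  exact ⟨⟨e'⟩, ⟨e'.symm.trans e⟩⟩
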